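/- Let $\alpha,\beta\in\mathbb{R}$ with $\beta\neq 0$. Put $w(0)=w(1)=1$, $w(x)=x^{\alpha}(\ln x)^{\beta}$ for integers $x\ge 2$, and $w(-1)=0$. Let $(X_n)_{n\ge 0}$ be the (un-reinforced) random walk on $\mathbb{Z}_+=\{0,1,2,\dots\}$ with weights $w$, where $w(x)$ is the weight of the edge $\{x,x+1\}$; that is, $X_0=0$ almost surely and $$P(X_{n+1}=X_n+1\mid X_0,\dots,X_n)=1-P(X_{n+1}=X_n-1\mid X_0,\dots,X_n)=\frac{w(X_n)}{w(X_n-1)+w(X_n)}.$$ Then the following hold for every $\varepsilon>0$. (i) If $\alpha<-1$, then almost surely $$\limsup_{n\to\infty}\frac{X_n}{n^{1/(1-\alpha+\varepsilon|\beta|)}}=+\infty,$$ and, if moreover $\varepsilon|\beta|<1-\alpha$, then almost surely $$\lim_{n\to\infty}\frac{X_n}{\{n(\ln n)^{1+\varepsilon}\}^{1/(1-\alpha-\varepsilon|\beta|)}}=0.$$ (ii.1) If $\alpha=-1$ and $\beta<-1$, then almost surely $$\limsup_{n\to\infty}\frac{X_n}{n^{1/(2-\varepsilon\beta)}}=+\infty,$$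 and, if moreover $\varepsilon|\beta|<2$, then almost surely $$\lim_{n\to\infty}\frac{X_n}{\{n(\ln n)^{1+\varepsilon}\}^{1/(2+\varepsilon\beta)}}=0.$$ (ii.2) If $\alpha=-1$ and $\beta\ge-1$, then almost surely $$\limsup_{n\to\infty}\frac{X_n}{n^{(1-\varepsilon)/2}}=+\infty\quad\text{and}\quad\lim_{n\to\infty}\frac{X_n}{\{n(\ln n)^{1+\varepsilon}\}^{1/2}}=0.$$ (iii) If $-1<\alpha\le 0$, then almost surely $$\limsup_{n\to\infty}\frac{X_n}{n^{1/2}}>0\quad\text{and}\quad\lim_{n\to\infty}\frac{X_n}{\{n(\ln n)^{1+\varepsilon}\}^{1/2}}=0.$$ (iv) If $0<\alpha<1$, or $\alpha=1$ and $\beta\le 1$, then almost surely $$\limsup_{n\to\infty}\frac{X_n}{n^{1/(2(1+\varepsilon|\beta|))}}=+\infty,$$ and, if moreover $\varepsilon|\beta|<1$, then almost surely $$\lim_{n\to\infty}\frac{X_n}{\{n(\ln n)^{1+\varepsilon}\}^{1/(2(1-\varepsilon|\beta|))}}=0.$$ -/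

import Mathlib

open MeasureTheory Filter Topology

noncomputable section

/-- The initial weight of the edge `{x, x + 1}`: it is `1` for `x = 0, 1` and
`x ^ α * (ln x) ^ β` for `x ≥ 2`. -/
def initialWeight (α β : ℝ) (x : ℕ) : ℝ :=
  if x ≤ 1 then 1 else (x : ℝ) ^ α * Real.log x ^ β

/-- The number of times that the path `p` has traversed the edge `{x, x + 1}` up to time `n`. -/
def crossings (p : ℕ → ℕ) (n x : ℕ) : ℕ :=
  ((Finset.Icc 1 n).filter fun i => s(p (i - 1), p i) = s(x, x + 1)).card

/-- The weight at time `n` of the edge `{x, x + 1}`, for a walk that has followed the path `p`. -/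
def edgeWeight (w₀ : ℕ → ℝ) (δ : ℝ) (p : ℕ → ℕ) (n x : ℕ) : ℝ :=
  w₀ x + δ * (crossings p n x : ℝ)

/-- The weight at time `n` of the edge `{x - 1, x}`, which is `0` for `x = 0`. -/
def leftEdgeWeight (w₀ : ℕ → ℝ) (δ : ℝ) (p : ℕ → ℕ) (n : ℕ) : ℕ → ℝ
  | 0 => 0
  | x + 1 => edgeWeight w₀ δ p n x

/-- The probability of a step to the right at time `n`, given that the path up to time `n`
is `p 0, …, p n`. -/
def upProb (w₀ : ℕ → ℝ) (δ : ℝ) (p : ℕ → ℕ) (n : ℕ) : ℝ :=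
  edgeWeight w₀ δ p n (p n) / (leftEdgeWeight w₀ δ p n (p n) + edgeWeight w₀ δ p n (p n))

/-- `X` is, under `μ`, a linearly edge-reinforced random walk on the nonnegative integers, started
at `0`, with initial weights `w₀` and reinforcement parameter `δ`; the un-reinforced walk is the
case `δ = 0`. The conditional probabilities given `X 0, …, X n` are those given the events
`X 0 = p 0, …, X n = p n` of positive probability. -/
structure IsLERRW {Ω : Type*} [MeasurableSpace Ω] (w₀ : ℕ → ℝ) (δ : ℝ) (μ : Measure Ω)
    (X : ℕ → Ω → ℕ) : Prop where
  measurable : ∀ n, Measurable (X n)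
  start : ∀ᵐ ω ∂μ, X 0 ω = 0
  step_up : ∀ (n : ℕ) (p : ℕ → ℕ), μ {ω | ∀ i ≤ n, X i ω = p i} ≠ 0 →
    (ProbabilityTheory.cond μ {ω | ∀ i ≤ n, X i ω = p i}).real {ω | X (n + 1) ω = X n ω + 1}
      = upProb w₀ δ p n
  step_down : ∀ (n : ℕ) (p : ℕ → ℕ), μ {ω | ∀ i ≤ n, X i ω = p i} ≠ 0 →
    (ProbabilityTheory.cond μ {ω | ∀ i ≤ n, X i ω = p i}).real {ω | X (n + 1) ω + 1 = X n ω}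
      = 1 - upProb w₀ δ p n

/-- `limsup x n / a n` for `n → ∞`, as an extended real number. -/
def limsupRatio (x : ℕ → ℕ) (a : ℕ → ℝ) : EReal :=
  limsup (fun n => (((x n : ℝ) / a n : ℝ) : EReal)) atTop

end

/-! Let `F = meanHittingTime w` and let `T x` be the hitting time of `x`. Each summand of `F` is the
mean passage time from `y` to `y + 1`, so `F (X n) - n` is a martingale (`upProb_meanHittingTime`),
and stopping it at `T x` gives E[min(T x, n)] = E[F(X stopped at T x, at time n)]
(`sum_measureReal_lt`). Hence P(T x > n) ≤ F x / (n + 1) and P(T x ≤ n) ≤ n / F x.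

The theorem thus reduces to the growth of `F`. Potter bounds (`initialWeight_potter`) absorb the
logarithmic factor into an arbitrarily small power and show that `F x` is at most of order x² for α
> -1 and x^(1 - α + γ) for α ≤ -1, and at least of order x² always, and x^(1 - α - γ).

Upper bounds on `F` make the walk reach `x` early for infinitely many `x`, which gives the limsup
claims (`ae_limsupRatio_eq_top`, `ae_limsupRatio_sqrt_pos`). Lower bounds on `F` give the limits, by
Borel–Cantelli along powers of 2 (`ae_eventually_lt`). -/

/-! ### Mean hitting times -/

/-- The mean time that the walk on `ℕ` with edge weights `w` takes from `0` to `x`. -/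
noncomputable def meanHittingTime (w : ℕ → ℝ) (x : ℕ) : ℝ :=
  ∑ y ∈ Finset.range x, (w y + 2 * ∑ z ∈ Finset.range y, w z) / w y

theorem meanHittingTime_succ (w : ℕ → ℝ) (x : ℕ) : meanHittingTime w (x + 1) =
    meanHittingTime w x + (w x + 2 * ∑ z ∈ Finset.range x, w z) / w x :=
  Finset.sum_range_succ _ _

theorem meanHittingTime_mono {w : ℕ → ℝ} (hw : ∀ x, 0 < w x) : Monotone (meanHittingTime w) := by
  refine monotone_nat_of_le_succ fun x => ?_
  rw [meanHittingTime_succ]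
  have := hw x
  have : 0 ≤ ∑ z ∈ Finset.range x, w z := Finset.sum_nonneg fun z _ => (hw z).le
  have : 0 ≤ (w x + 2 * ∑ z ∈ Finset.range x, w z) / w x := by positivity
  linarith

theorem meanHittingTime_nonneg {w : ℕ → ℝ} (hw : ∀ x, 0 < w x) (x : ℕ) :
    0 ≤ meanHittingTime w x := by
  simpa [meanHittingTime] using meanHittingTime_mono hw (Nat.zero_le x)

/-- One step of the walk raises `meanHittingTime` by 1 on average. At the origin the truncated `p n
- 1` is harmless, because the step is upward with probability 1. -/
theorem upProb_meanHittingTime {w : ℕ → ℝ} (hw : ∀ x, 0 < w x) (p : ℕ → ℕ) (n : ℕ) :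
    upProb w 0 p n * meanHittingTime w (p n + 1)
      + (1 - upProb w 0 p n) * meanHittingTime w (p n - 1) = meanHittingTime w (p n) + 1 := by
  rcases h : p n with _ | y
  · have := (hw 0).ne'
    simp [upProb, h, leftEdgeWeight, edgeWeight, meanHittingTime, this]
  · have h1 := hw y
    have h2 := hw (y + 1)
    have h3 : w y + w (y + 1) ≠ 0 := by positivity
    simp only [upProb, h, leftEdgeWeight, edgeWeight, zero_mul, add_zero, Nat.add_sub_cancel]
    rw [meanHittingTime_succ w (y + 1), meanHittingTime_succ w y, Finset.sum_range_succ]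
    field_simp
    ring

/-! ### Optional stopping and tail bounds for hitting times -/

section Walk

variable {Ω : Type*} [MeasurableSpace Ω] {μ : Measure Ω} {X : ℕ → Ω → ℕ} {w : ℕ → ℝ} {δ : ℝ}

theorem IsLERRW.measurableSet_cylinder (hX : IsLERRW w δ μ X) (n : ℕ) (p : ℕ → ℕ) :
    MeasurableSet {ω | ∀ i ≤ n, X i ω = p i} := by
  simp only [Set.ofPred_forall]
  exact MeasurableSet.iInter fun i => MeasurableSet.iInter fun _ =>
    hX.measurable i (measurableSet_singleton (p i))

theorem IsLERRW.measurableSet_lt (hX : IsLERRW w δ μ X) (n x : ℕ) :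
    MeasurableSet {ω | ∀ i ≤ n, X i ω < x} := by
  simp only [Set.ofPred_forall]
  exact MeasurableSet.iInter fun i => MeasurableSet.iInter fun _ =>
    hX.measurable i (measurableSet_Iio (a := x))

theorem IsLERRW.integrable_comp [IsFiniteMeasure μ] (hX : IsLERRW w δ μ X) {G : ℕ → ℝ} {B : ℝ}
    (hG : ∀ y, |G y| ≤ B) (n : ℕ) : Integrable (fun ω => G (X n ω)) μ :=
  Integrable.of_bound ((measurable_of_countable G).comp (hX.measurable n)).aestronglyMeasurable B
    (ae_of_all _ fun _ => hG _)

/-- The up and down probabilities add up to 1, so almost every path in the cylinder moves to a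
neighbour, and `G` is constant on each of the two pieces. -/
theorem IsLERRW.setIntegral_cylinder [IsProbabilityMeasure μ] (hX : IsLERRW w δ μ X)
    (n : ℕ) (p : ℕ → ℕ) {G : ℕ → ℝ} {B : ℝ} (hG : ∀ y, |G y| ≤ B) :
    ∫ ω in {ω | ∀ i ≤ n, X i ω = p i}, G (X (n + 1) ω) ∂μ =
      μ.real {ω | ∀ i ≤ n, X i ω = p i} *
        (upProb w δ p n * G (p n + 1) + (1 - upProb w δ p n) * G (p n - 1)) := by
  have hC := hX.measurableSet_cylinder n p
  have hup := hX.step_up n p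
  have hdown := hX.step_down n p
  set C := {ω | ∀ i ≤ n, X i ω = p i} with hCdef
  set U := {ω | X (n + 1) ω = X n ω + 1}
  set D := {ω | X (n + 1) ω + 1 = X n ω}
  by_cases h0 : μ C = 0
  · simp [setIntegral_measure_zero _ h0, Measure.real, h0]
  have hU : MeasurableSet U :=
    measurableSet_eq_fun (hX.measurable _) ((hX.measurable n).add_const 1)
  have hD : MeasurableSet D :=
    measurableSet_eq_fun ((hX.measurable _).add_const 1) (hX.measurable n)
  have hr : μ.real C ≠ 0 := by
    simp [Measure.real, ENNReal.toReal_eq_zero_iff, h0]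
  have hcond : ∀ t : Set Ω, (ProbabilityTheory.cond μ C).real t = (μ.real C)⁻¹ * μ.real (C ∩ t) :=
    fun t => by
      rw [Measure.real, ProbabilityTheory.cond_apply hC, ENNReal.toReal_mul, ENNReal.toReal_inv,
        Measure.real, Measure.real]
  have hCU : μ.real (C ∩ U) = μ.real C * upProb w δ p n := by
    rw [← hup h0, hcond]
    field_simp
  have hCD : μ.real (C ∩ D) = μ.real C * (1 - upProb w δ p n) := by
    rw [← hdown h0, hcond]
    field_simp
  have hdisj : Disjoint (C ∩ U) (C ∩ D) := by
    rw [Set.disjoint_left]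
    rintro ω ⟨_, h1⟩ ⟨_, h2⟩
    simp only [U, D, Set.mem_ofPred_eq] at h1 h2
    omega
  have hunion : μ.real (C ∩ U ∪ C ∩ D) = μ.real C := by
    rw [measureReal_union hdisj (hC.inter hD), hCU, hCD]
    ring
  have hae : (C ∩ U ∪ C ∩ D : Set Ω) =ᵐ[μ] C := by
    refine ae_eq_of_subset_of_measure_ge
      (Set.union_subset Set.inter_subset_left Set.inter_subset_left) ?_
      ((hC.inter hU).union (hC.inter hD)).nullMeasurableSet (measure_ne_top _ _)
    exact ((measureReal_eq_measureReal_iff).1 hunion).ge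
  have hint := hX.integrable_comp hG (n + 1)
  rw [← setIntegral_congr_set hae, setIntegral_union hdisj (hC.inter hD) hint.integrableOn
    hint.integrableOn,
    setIntegral_congr_fun (g := fun _ => G (p n + 1)) (hC.inter hU),
    setIntegral_congr_fun (g := fun _ => G (p n - 1)) (hC.inter hD), setIntegral_const,
    setIntegral_const, hCU, hCD]
  · simp only [smul_eq_mul]
    ring
  · rintro ω ⟨h1, h2⟩
    have h3 : X n ω = p n := h1 n le_rfl
    simp only [D, Set.mem_ofPred_eq] at h2
    show G _ = G _
    congr 1
    omega
  · rintro ω ⟨h1, h2⟩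
    have h3 : X n ω = p n := h1 n le_rfl
    simp only [U, Set.mem_ofPred_eq] at h2
    show G _ = G _
    rw [h2, h3]

/-- The event splits into finitely many cylinders, and the one-step identity holds on each.
Truncation at `x` keeps the integrand bounded and changes nothing here: a walk still below `x`
reaches at most `x` in one step. -/
theorem IsLERRW.setIntegral_meanHittingTime_succ [IsProbabilityMeasure μ] (hX : IsLERRW w 0 μ X)
    (hw : ∀ x, 0 < w x) (n x : ℕ) :
    ∫ ω in {ω | ∀ i ≤ n, X i ω < x}, meanHittingTime w (min (X (n + 1) ω) x) ∂μ =
      ∫ ω in {ω | ∀ i ≤ n, X i ω < x}, meanHittingTime w (min (X n ω) x) ∂μ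
        + μ.real {ω | ∀ i ≤ n, X i ω < x} := by
  -- Finite paths are extended by the junk value 0 after time `n`; only times up to `n` are used.
  let P : (Fin (n + 1) → Fin x) → ℕ → ℕ := fun q i => if h : i < n + 1 then (q ⟨i, h⟩ : ℕ) else 0
  let C : (Fin (n + 1) → Fin x) → Set Ω := fun q => {ω | ∀ i ≤ n, X i ω = P q i}
  have hPi : ∀ q i (hi : i ≤ n), P q i = (q ⟨i, Nat.lt_succ_of_le hi⟩ : ℕ) :=
    fun q i hi => dif_pos (Nat.lt_succ_of_le hi)
  have hP : ∀ q i, i ≤ n → P q i < x := by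
    intro q i hi
    rw [hPi q i hi]
    exact Fin.is_lt _
  have hN : {ω | ∀ i ≤ n, X i ω < x} = ⋃ q, C q := by
    ext ω
    simp only [Set.mem_ofPred_eq, Set.mem_iUnion, C]
    constructor
    · intro h
      let q : Fin (n + 1) → Fin x := fun i => ⟨X i ω, h i (Nat.le_of_lt_succ i.2)⟩
      exact ⟨q, fun i hi => (hPi q i hi).symm⟩
    · rintro ⟨q, hq⟩ i hi
      rw [hq i hi]
      exact hP q i hi
  have hdisj : Pairwise (Function.onFun Disjoint C) := by
    intro q q' hqq
    rw [Function.onFun, Set.disjoint_left]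
    intro ω h1 h2
    apply hqq
    funext i
    have e := (h1 i (Nat.le_of_lt_succ i.2)).symm.trans (h2 i (Nat.le_of_lt_succ i.2))
    rw [hPi _ _ (Nat.le_of_lt_succ i.2), hPi _ _ (Nat.le_of_lt_succ i.2)] at e
    exact Fin.ext e
  have hm : ∀ q, MeasurableSet (C q) := fun q => hX.measurableSet_cylinder n _
  have hG : ∀ y, |meanHittingTime w (min y x)| ≤ meanHittingTime w x := fun y => by
    rw [abs_of_nonneg (meanHittingTime_nonneg hw _)]
    exact meanHittingTime_mono hw (min_le_right _ _)
  have hi : ∀ k, Integrable (fun ω => meanHittingTime w (min (X k ω) x)) μ :=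
    fun k => hX.integrable_comp hG k
  rw [hN, integral_iUnion_fintype hm hdisj fun _ => (hi _).integrableOn,
    integral_iUnion_fintype hm hdisj fun _ => (hi _).integrableOn,
    measureReal_iUnion_fintype hdisj hm, ← Finset.sum_add_distrib]
  refine Finset.sum_congr rfl fun q _ => ?_
  have hlt := hP q n le_rfl
  rw [hX.setIntegral_cylinder n (P q) hG, setIntegral_congr_fun
    (g := fun _ => meanHittingTime w (P q n)) (hm q), setIntegral_const, smul_eq_mul,
    min_eq_left (show P q n + 1 ≤ x by omega), min_eq_left (show P q n - 1 ≤ x by omega),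
    upProb_meanHittingTime hw]
  · ring
  · intro ω h
    show meanHittingTime w _ = meanHittingTime w _
    rw [h n le_rfl, min_eq_left hlt.le]

/-- The optional stopping identity for the time at which the walk reaches `x`. -/
theorem IsLERRW.sum_measureReal_lt [IsProbabilityMeasure μ] (hX : IsLERRW w 0 μ X)
    (hw : ∀ x, 0 < w x) {x : ℕ} (hx : 0 < x) (n : ℕ) :
    ∑ k ∈ Finset.range n, μ.real {ω | ∀ i ≤ k, X i ω < x} =
      ∫ ω in {ω | ∀ i ≤ n, X i ω < x}, meanHittingTime w (min (X n ω) x) ∂μ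
        + meanHittingTime w x * (1 - μ.real {ω | ∀ i ≤ n, X i ω < x}) := by
  have hG : ∀ y, |meanHittingTime w (min y x)| ≤ meanHittingTime w x := fun y => by
    rw [abs_of_nonneg (meanHittingTime_nonneg hw _)]
    exact meanHittingTime_mono hw (min_le_right _ _)
  induction n with
  | zero =>
    have h1 : ∀ᵐ ω ∂μ, ω ∈ {ω | ∀ i ≤ 0, X i ω < x} := by
      filter_upwards [hX.start] with ω h
      intro i hi
      rw [Nat.le_zero.1 hi, h]
      exact hx
    have h2 : μ.real {ω | ∀ i ≤ 0, X i ω < x} = 1 := by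
      rw [Measure.real, (prob_compl_eq_zero_iff (hX.measurableSet_lt 0 x)).1 h1]
      simp
    rw [h2, setIntegral_eq_zero_of_ae_eq_zero]
    · simp
    · filter_upwards [hX.start] with ω h _
      simp [h, meanHittingTime]
  | succ n ih =>
    have hA := hX.measurableSet_lt n x
    have hB := hX.measurableSet_lt (n + 1) x
    have hstep := hX.setIntegral_meanHittingTime_succ hw n x
    set A := {ω | ∀ i ≤ n, X i ω < x}
    set B := {ω | ∀ i ≤ n + 1, X i ω < x}
    have hBA : B ⊆ A := fun ω h i hi => h i (hi.trans (Nat.le_succ n))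
    have hi := hX.integrable_comp hG (n + 1)
    -- `A \ B` is the event that `x` is first reached at time `n + 1`; there the truncated integrand
    -- equals `meanHittingTime w x`.
    have hsplit := setIntegral_union (μ := μ) (s := B) (t := A \ B) Set.disjoint_sdiff_right
      (hA.diff hB) hi.integrableOn hi.integrableOn
    rw [Set.union_sdiff_cancel hBA, setIntegral_congr_fun (s := A \ B)
      (g := fun _ => meanHittingTime w x) (hA.diff hB), setIntegral_const, smul_eq_mul,
      measureReal_sdiff hBA hB] at hsplit
    · rw [Finset.sum_range_succ, ih]
      linarith
    · rintro ω ⟨h1, h2⟩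
      have h3 : x ≤ X (n + 1) ω := by
        by_contra! h4
        refine h2 fun i hi => ?_
        rcases Nat.le_succ_iff.1 hi with h | h
        · exact h1 i h
        · rw [h]
          exact h4
      show meanHittingTime w _ = meanHittingTime w _
      rw [min_eq_right h3]

/-- The probabilities of not having reached `x` decrease in time, so their sum up to time `n` is at
least `n + 1` times the last one, while the stopped martingale never exceeds `meanHittingTime w x`.
-/
theorem IsLERRW.measureReal_lt_le [IsProbabilityMeasure μ] (hX : IsLERRW w 0 μ X)
    (hw : ∀ x, 0 < w x) {x : ℕ} (hx : 0 < x) (n : ℕ) :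
    (n + 1) * μ.real {ω | ∀ i ≤ n, X i ω < x} ≤ meanHittingTime w x := by
  have h := hX.sum_measureReal_lt hw hx (n + 1)
  have h1 : (n + 1) * μ.real {ω | ∀ i ≤ n, X i ω < x} ≤
      ∑ k ∈ Finset.range (n + 1), μ.real {ω | ∀ i ≤ k, X i ω < x} := by
    have := Finset.card_nsmul_le_sum (Finset.range (n + 1))
      (fun k => μ.real {ω | ∀ i ≤ k, X i ω < x}) (μ.real {ω | ∀ i ≤ n, X i ω < x}) fun k hk =>
        measureReal_mono fun ω h i hi => h i (hi.trans (Finset.mem_range_succ_iff.1 hk))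
    simpa using this
  have h2 : ∫ ω in {ω | ∀ i ≤ n + 1, X i ω < x}, meanHittingTime w (min (X (n + 1) ω) x) ∂μ ≤
      meanHittingTime w x * μ.real {ω | ∀ i ≤ n + 1, X i ω < x} := by
    refine (Real.le_norm_self _).trans (norm_setIntegral_le_of_norm_le_const
      (measure_lt_top _ _) fun ω _ => ?_)
    rw [Real.norm_of_nonneg (meanHittingTime_nonneg hw _)]
    exact meanHittingTime_mono hw (min_le_right _ _)
  linarith

/-- In the same identity, bound each probability in the sum by 1 and drop the nonnegative
contribution of paths still below `x`. -/
theorem IsLERRW.measureReal_exists_ge_le [IsProbabilityMeasure μ] (hX : IsLERRW w 0 μ X)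
    (hw : ∀ x, 0 < w x) {x : ℕ} (hx : 0 < x) (n : ℕ) :
    meanHittingTime w x * μ.real {ω | ∃ i ≤ n, x ≤ X i ω} ≤ n := by
  have h := hX.sum_measureReal_lt hw hx n
  have h1 : ∑ k ∈ Finset.range n, μ.real {ω | ∀ i ≤ k, X i ω < x} ≤ n := by
    have := Finset.sum_le_card_nsmul (Finset.range n)
      (fun k => μ.real {ω | ∀ i ≤ k, X i ω < x}) 1 fun k _ => measureReal_le_one
    simpa using this
  have h2 : 0 ≤ ∫ ω in {ω | ∀ i ≤ n, X i ω < x}, meanHittingTime w (min (X n ω) x) ∂μ :=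
    integral_nonneg fun ω => meanHittingTime_nonneg hw _
  have h3 : {ω | ∃ i ≤ n, x ≤ X i ω} = {ω | ∀ i ≤ n, X i ω < x}ᶜ := by
    ext ω
    simp
  rw [h3, probReal_compl_eq_one_sub (hX.measurableSet_lt n x)]
  linarith

end Walk

/-! ### Potter bounds for the weights -/

/-- This is `log t ≤ t - 1` at `t = γ * a₀ * (b / a)`. Applied to logarithms, it bounds increments
of log log by a small multiple of those of log, up to a constant. -/
theorem log_sub_log_le_mul_add {γ a₀ : ℝ} (hγ : 0 < γ) (ha₀ : 0 < a₀) : ∃ K : ℝ, 0 ≤ K ∧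
    ∀ a b, a₀ ≤ a → a ≤ b → Real.log b - Real.log a ≤ γ * (b - a) + K := by
  refine ⟨|γ * a₀ - 1 - Real.log (γ * a₀)|, abs_nonneg _, fun a b ha hab => ?_⟩
  have ha' : 0 < a := ha₀.trans_le ha
  have hb' : 0 < b := ha'.trans_le hab
  have h1 : b / a ≤ 1 + (b - a) / a₀ := by
    have : b / a = 1 + (b - a) / a := by field_simp; ring
    rw [this]
    gcongr
  have h2 := Real.log_le_sub_one_of_pos (show 0 < γ * a₀ * (b / a) by positivity)
  rw [Real.log_mul (by positivity) (by positivity),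
    Real.log_div (by positivity) (by positivity)] at h2
  have h3 := mul_le_mul_of_nonneg_left h1 (show 0 ≤ γ * a₀ by positivity)
  have h4 : γ * a₀ * (1 + (b - a) / a₀) = γ * a₀ + γ * (b - a) := by field_simp
  linarith [le_abs_self (γ * a₀ - 1 - Real.log (γ * a₀))]

theorem initialWeight_pos (α β : ℝ) (x : ℕ) : 0 < initialWeight α β x := by
  unfold initialWeight
  split_ifs with h
  · exact one_pos
  · have : (1 : ℝ) < x := by exact_mod_cast not_le.1 h
    have := Real.log_pos this
    positivity

/-- The shifts by 1 and 2 keep both logarithmic arguments positive from `x = 0` on, at the price of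
a bounded error, so later estimates need no case split. -/
theorem exists_abs_log_initialWeight_sub_le (α β : ℝ) : ∃ K : ℝ, 0 ≤ K ∧ ∀ x : ℕ,
    |Real.log (initialWeight α β x) - α * Real.log (x + 1 : ℝ)
      - β * Real.log (Real.log (x + 2 : ℝ))| ≤ K := by
  obtain ⟨K₁, hK₁, h₁⟩ := log_sub_log_le_mul_add one_pos (Real.log_pos one_lt_two)
  have hsum : ∀ x : ℕ, 2 ≤ x → |Real.log (initialWeight α β x) - α * Real.log (x + 1 : ℝ)
      - β * Real.log (Real.log (x + 2 : ℝ))| ≤ |α| * Real.log 2 + |β| * (Real.log 2 + K₁) := by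
    intro x hx
    have hx' : (2 : ℝ) ≤ x := by exact_mod_cast hx
    have hl := Real.log_le_log two_pos hx'
    have hl2 := Real.log_pos one_lt_two
    have hlx : 0 < Real.log x := by linarith
    have e : Real.log (initialWeight α β x) = α * Real.log x + β * Real.log (Real.log x) := by
      rw [initialWeight, if_neg (by omega), Real.log_mul (by positivity) (by positivity),
        Real.log_rpow (by positivity), Real.log_rpow hlx]
    have d : ∀ c : ℝ, 0 ≤ c → c ≤ 2 →
        0 ≤ Real.log (x + c) - Real.log x ∧ Real.log (x + c) - Real.log x ≤ Real.log 2 := by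
      intro c hc hc'
      constructor
      · linarith [Real.log_le_log (by positivity : (0 : ℝ) < x) (by linarith : (x : ℝ) ≤ x + c)]
      · have := Real.log_le_log (by positivity : (0 : ℝ) < x + c) (by linarith : x + c ≤ 2 * x)
        rw [Real.log_mul (by positivity) (by positivity)] at this
        linarith
    obtain ⟨d1, d1'⟩ := d 1 (by norm_num) (by norm_num)
    obtain ⟨d2, d2'⟩ := d 2 (by norm_num) (by norm_num)
    have d3 := h₁ (Real.log x) (Real.log (x + 2)) hl (by linarith)
    have d4 := Real.log_le_log hlx (by linarith : Real.log x ≤ Real.log (x + 2))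
    have e2 : Real.log (initialWeight α β x) - α * Real.log (x + 1 : ℝ)
        - β * Real.log (Real.log (x + 2 : ℝ)) = -(α * (Real.log (x + 1) - Real.log x)
          + β * (Real.log (Real.log (x + 2)) - Real.log (Real.log x))) := by
      rw [e]; ring
    rw [e2, abs_neg]
    refine (abs_add_le _ _).trans ?_
    rw [abs_mul, abs_mul, abs_of_nonneg d1, abs_of_nonneg (by linarith :
      0 ≤ Real.log (Real.log (x + 2)) - Real.log (Real.log (x : ℝ)))]
    gcongr
    linarith
  have hl2 := Real.log_pos one_lt_two
  set f : ℕ → ℝ := fun x => |Real.log (initialWeight α β x) - α * Real.log (x + 1 : ℝ)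
      - β * Real.log (Real.log (x + 2 : ℝ))|
  refine ⟨(|α| * Real.log 2 + |β| * (Real.log 2 + K₁)) + f 0 + f 1, by positivity, fun x => ?_⟩
  have f0 : 0 ≤ f 0 := abs_nonneg _
  have f1 : 0 ≤ f 1 := abs_nonneg _
  have hc : 0 ≤ |α| * Real.log 2 + |β| * (Real.log 2 + K₁) := by positivity
  match x with
  | 0 => change f 0 ≤ _; linarith
  | 1 => change f 1 ≤ _; linarith
  | x + 2 => have := hsum (x + 2) (by omega); linarith

theorem abs_log_initialWeight_sub_sub_le (α β : ℝ) {γ : ℝ} (hγ : 0 < γ) : ∃ K : ℝ, ∀ z y : ℕ,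
    z ≤ y → |Real.log (initialWeight α β y) - Real.log (initialWeight α β z)
        - α * (Real.log (y + 1 : ℝ) - Real.log (z + 1 : ℝ))|
      ≤ γ * (Real.log (y + 1 : ℝ) - Real.log (z + 1 : ℝ)) + K := by
  obtain ⟨K₁, hK₁, h₁⟩ := exists_abs_log_initialWeight_sub_le α β
  -- Using `|β| + 1` instead of `|β|` permits division when `β = 0`.
  have hb : 0 < |β| + 1 := by positivity
  obtain ⟨K₂, hK₂, h₂⟩ := log_sub_log_le_mul_add (div_pos hγ hb) (Real.log_pos one_lt_two)
  refine ⟨2 * K₁ + (|β| + 1) * K₂, fun z y hzy => ?_⟩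
  have hzy' : (z : ℝ) ≤ y := by exact_mod_cast hzy
  have hz : (0 : ℝ) ≤ z := z.cast_nonneg
  have hlz := Real.log_le_log two_pos (by linarith : (2 : ℝ) ≤ z + 2)
  have hl2 := Real.log_pos one_lt_two
  have hlzy := Real.log_le_log (by positivity) (by linarith : (z + 2 : ℝ) ≤ y + 2)
  have hll := Real.log_le_log (by linarith) hlzy
  have h3 := h₂ _ _ hlz hlzy
  have h4 : Real.log (y + 2) - Real.log (z + 2) ≤ Real.log (y + 1) - Real.log (z + 1 : ℝ) := by
    rw [← Real.log_div (by positivity) (by positivity),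
      ← Real.log_div (by positivity) (by positivity)]
    apply Real.log_le_log (by positivity)
    rw [div_le_div_iff₀ (by positivity) (by positivity)]
    nlinarith
  have h5 : |β * (Real.log (Real.log (y + 2)) - Real.log (Real.log (z + 2)))| ≤
      γ * (Real.log (y + 1 : ℝ) - Real.log (z + 1 : ℝ)) + (|β| + 1) * K₂ := by
    rw [abs_mul, abs_of_nonneg (sub_nonneg.2 hll)]
    calc |β| * (Real.log (Real.log (y + 2)) - Real.log (Real.log (z + 2)))
        ≤ (|β| + 1) * (Real.log (Real.log (y + 2)) - Real.log (Real.log (z + 2))) := by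
          exact mul_le_mul_of_nonneg_right (by linarith) (sub_nonneg.2 hll)
      _ ≤ (|β| + 1) * (γ / (|β| + 1) * (Real.log (y + 2) - Real.log (z + 2)) + K₂) := by gcongr
      _ = γ * (Real.log (y + 2) - Real.log (z + 2)) + (|β| + 1) * K₂ := by field_simp
      _ ≤ _ := by gcongr
  have hy1 := abs_le.1 (h₁ y)
  have hz1 := abs_le.1 (h₁ z)
  have h5 := abs_le.1 h5
  rw [abs_le]
  constructor <;> linarith [h5.1, h5.2, hy1.1, hy1.2, hz1.1, hz1.2]

/-- A bound of Potter type for the regularly varying sequence `initialWeight α β`. -/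
theorem initialWeight_potter (α β : ℝ) {γ : ℝ} (hγ : 0 < γ) : ∃ C : ℝ, 0 < C ∧ ∀ z y : ℕ, z ≤ y →
    initialWeight α β y ≤ C * ((y + 1 : ℝ) / (z + 1)) ^ (α + γ) * initialWeight α β z ∧
    initialWeight α β z ≤ C * ((y + 1 : ℝ) / (z + 1)) ^ (γ - α) * initialWeight α β y := by
  obtain ⟨K, hK⟩ := abs_log_initialWeight_sub_sub_le α β hγ
  refine ⟨Real.exp K, Real.exp_pos K, fun z y hzy => ?_⟩
  have h := abs_le.1 (hK z y hzy)
  have hr : (0 : ℝ) < (y + 1 : ℝ) / (z + 1) := by positivity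
  have hy := initialWeight_pos α β y
  have hz := initialWeight_pos α β z
  have key : ∀ a u v : ℝ, 0 < u → 0 < v →
      Real.log u ≤ K + a * (Real.log (y + 1 : ℝ) - Real.log (z + 1 : ℝ)) + Real.log v →
      u ≤ Real.exp K * ((y + 1 : ℝ) / (z + 1)) ^ a * v := by
    intro a u v hu hv huv
    rw [← Real.log_le_log_iff hu (by positivity), Real.log_mul (by positivity) hv.ne',
      Real.log_mul (by positivity) (by positivity), Real.log_exp, Real.log_rpow hr,
      Real.log_div (by positivity) (by positivity)]
    exact huv
  exact ⟨key _ _ _ hy hz (by linarith [h.2]), key _ _ _ hz hy (by linarith [h.1])⟩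

/-! ### Growth of the mean hitting time -/

theorem natCast_succ_rpow_mul_one_sub {p : ℝ} (n : ℕ) :
    (n : ℝ) ^ p = ((n : ℝ) + 1) ^ p * (1 + -(1 / ((n : ℝ) + 1))) ^ p := by
  have h0 : (0 : ℝ) < (n : ℝ) + 1 := by positivity
  have e : 1 + -(1 / ((n : ℝ) + 1)) = n / (n + 1) := by field_simp; ring
  rw [e, ← Real.mul_rpow h0.le (by positivity)]
  congr 1
  field_simp

/-- The induction step is Bernoulli's inequality for `(1 - 1 / (n + 1)) ^ p`, scaled by `(n + 1) ^
p`. For `p ≤ 1` Bernoulli reverses, which gives `mul_sum_rpow_le_rpow`. -/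
theorem rpow_le_mul_sum_rpow {p : ℝ} (hp : 1 ≤ p) (n : ℕ) :
    (n : ℝ) ^ p ≤ p * ∑ z ∈ Finset.range n, ((z : ℝ) + 1) ^ (p - 1) := by
  induction n with
  | zero => simp [Real.zero_rpow (by linarith : p ≠ 0)]
  | succ n ih =>
    have h0 : (0 : ℝ) < (n : ℝ) + 1 := by positivity
    have hs : -1 ≤ -(1 / ((n : ℝ) + 1)) := by
      rw [neg_le_neg_iff, div_le_one h0]; linarith [(Nat.cast_nonneg n : (0 : ℝ) ≤ n)]
    have hb := mul_le_mul_of_nonneg_left (one_add_mul_self_le_rpow_one_add hs hp)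
      (Real.rpow_nonneg h0.le p)
    rw [← natCast_succ_rpow_mul_one_sub] at hb
    have e : ((n : ℝ) + 1) ^ p * (1 + p * -(1 / ((n : ℝ) + 1)))
        = ((n : ℝ) + 1) ^ p - p * ((n : ℝ) + 1) ^ (p - 1) := by
      rw [Real.rpow_sub_one h0.ne']; ring
    rw [Finset.sum_range_succ]
    push_cast
    linarith

theorem mul_sum_rpow_le_rpow {p : ℝ} (hp : 0 < p) (hp' : p ≤ 1) (n : ℕ) :
    p * ∑ z ∈ Finset.range n, ((z : ℝ) + 1) ^ (p - 1) ≤ (n : ℝ) ^ p := by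
  induction n with
  | zero => simp [Real.zero_rpow hp.ne']
  | succ n ih =>
    have h0 : (0 : ℝ) < (n : ℝ) + 1 := by positivity
    have hs : -1 ≤ -(1 / ((n : ℝ) + 1)) := by
      rw [neg_le_neg_iff, div_le_one h0]; linarith [(Nat.cast_nonneg n : (0 : ℝ) ≤ n)]
    have hb := mul_le_mul_of_nonneg_left (rpow_one_add_le_one_add_mul_self hs hp.le hp')
      (Real.rpow_nonneg h0.le p)
    rw [← natCast_succ_rpow_mul_one_sub] at hb
    have e : ((n : ℝ) + 1) ^ p * (1 + p * -(1 / ((n : ℝ) + 1)))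
        = ((n : ℝ) + 1) ^ p - p * ((n : ℝ) + 1) ^ (p - 1) := by
      rw [Real.rpow_sub_one h0.ne']; ring
    rw [Finset.sum_range_succ]
    push_cast
    linarith

theorem sum_range_succ_le_add_two_mul {w : ℕ → ℝ} (hw : ∀ x, 0 < w x) (y : ℕ) :
    ∑ z ∈ Finset.range (y + 1), w z ≤ w y + 2 * ∑ z ∈ Finset.range y, w z := by
  have : 0 ≤ ∑ z ∈ Finset.range y, w z := Finset.sum_nonneg fun z _ => (hw z).le
  rw [Finset.sum_range_succ]
  linarith

theorem add_two_mul_le_two_mul_sum_range_succ {w : ℕ → ℝ} (hw : ∀ x, 0 < w x) (y : ℕ) :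
    w y + 2 * ∑ z ∈ Finset.range y, w z ≤ 2 * ∑ z ∈ Finset.range (y + 1), w z := by
  rw [Finset.sum_range_succ]
  linarith [hw y]

theorem meanHittingTime_le_of_le {w : ℕ → ℝ} {C b : ℝ} (hw : ∀ x, 0 < w x) (hC : 0 ≤ C)
    (hb : 0 ≤ b) (h : ∀ y, ∑ z ∈ Finset.range (y + 1), w z ≤ C * ((y : ℝ) + 1) ^ b * w y) (x : ℕ) :
    meanHittingTime w x ≤ 2 * C * (x : ℝ) ^ (1 + b) := by
  have hterm : ∀ y ∈ Finset.range x, (w y + 2 * ∑ z ∈ Finset.range y, w z) / w y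
      ≤ 2 * C * (x : ℝ) ^ b := by
    intro y hy
    have hyx : (y : ℝ) + 1 ≤ x := by exact_mod_cast Finset.mem_range.1 hy
    rw [div_le_iff₀ (hw y)]
    calc _ ≤ 2 * ∑ z ∈ Finset.range (y + 1), w z := add_two_mul_le_two_mul_sum_range_succ hw y
      _ ≤ 2 * (C * ((y : ℝ) + 1) ^ b * w y) := by gcongr; exact h y
      _ ≤ 2 * (C * (x : ℝ) ^ b * w y) := by gcongr; exact (hw y).le
      _ = _ := by ring
  have := Finset.sum_le_card_nsmul _ _ _ hterm
  rw [Finset.card_range, nsmul_eq_mul] at this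
  refine this.trans_eq ?_
  rw [Real.rpow_add_of_nonneg x.cast_nonneg zero_le_one hb, Real.rpow_one]
  ring

/-- For `α > -1` the partial sums of the weights are at most of order `y` times the last weight, so
each passage time grows at most linearly. -/
theorem meanHittingTime_initialWeight_le_sq {α : ℝ} (β : ℝ) (hα : -1 < α) : ∃ C : ℝ, 0 < C ∧
    ∀ x : ℕ, meanHittingTime (initialWeight α β) x ≤ C * (x : ℝ) ^ (2 : ℝ) := by
  -- `b` is the Potter exponent `γ - α`: `-α < b` makes `γ` positive, and `b < 1` makes the sum of
  -- `(z + 1) ^ (-b)` of order `y ^ (1 - b)`.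
  obtain ⟨b, hb0, hb1, hbα⟩ : ∃ b : ℝ, 0 < b ∧ b < 1 ∧ -α < b := by
    obtain ⟨b, h1, h2⟩ := exists_between (max_lt (by linarith : -α < 1) one_pos)
    exact ⟨b, (le_max_right _ _).trans_lt h1, h2, (le_max_left _ _).trans_lt h1⟩
  obtain ⟨C, hC, h⟩ := initialWeight_potter α β (γ := b + α) (by linarith)
  have hb1' : 0 < 1 - b := by linarith
  refine ⟨2 * (C / (1 - b)), by positivity, fun x => ?_⟩
  have := meanHittingTime_le_of_le (initialWeight_pos α β) (C := C / (1 - b)) (b := 1)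
    (by positivity) zero_le_one (fun y => ?_) x
  · rwa [show (1 + 1 : ℝ) = 2 by norm_num] at this
  have hy : (0 : ℝ) < (y : ℝ) + 1 := by positivity
  have hw := initialWeight_pos α β y
  calc ∑ z ∈ Finset.range (y + 1), initialWeight α β z
      ≤ ∑ z ∈ Finset.range (y + 1), C * ((y : ℝ) + 1) ^ b * initialWeight α β y
          * ((z : ℝ) + 1) ^ ((1 - b) - 1) := by
        refine Finset.sum_le_sum fun z hz => ?_
        refine (h z y (Finset.mem_range_succ_iff.1 hz)).2.trans_eq ?_
        rw [add_sub_cancel_right, Real.div_rpow hy.le (by positivity),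
          show (1 - b - 1 : ℝ) = -b by ring, Real.rpow_neg (by positivity)]
        ring
    _ = C / (1 - b) * ((y : ℝ) + 1) ^ b * initialWeight α β y *
          ((1 - b) * ∑ z ∈ Finset.range (y + 1), ((z : ℝ) + 1) ^ ((1 - b) - 1)) := by
        rw [← Finset.mul_sum]
        field_simp
    _ ≤ C / (1 - b) * ((y : ℝ) + 1) ^ b * initialWeight α β y * ((y + 1 : ℕ) : ℝ) ^ (1 - b) := by
        gcongr
        exact mul_sum_rpow_le_rpow hb1' (by linarith) _
    _ = _ := by
        push_cast
        rw [Real.rpow_sub hy, Real.rpow_one]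
        field_simp

/-- Here the Potter exponent `γ - α` exceeds 1, so the weights summed up to `y` cost only a
convergent series times `(y + 1) ^ (γ - α)` times the last weight. -/
theorem meanHittingTime_initialWeight_le_rpow {α γ : ℝ} (β : ℝ) (hα : α ≤ -1) (hγ : 0 < γ) :
    ∃ C : ℝ, 0 < C ∧
      ∀ x : ℕ, meanHittingTime (initialWeight α β) x ≤ C * (x : ℝ) ^ (1 - α + γ) := by
  obtain ⟨C, hC, h⟩ := initialWeight_potter α β hγ
  have hs : Summable fun z : ℕ => ((z : ℝ) + 1) ^ (-(γ - α)) := by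
    have := (summable_nat_add_iff 1).2
      (Real.summable_nat_rpow (p := -(γ - α)).2 (by linarith))
    simpa using this
  set S := ∑' z : ℕ, ((z : ℝ) + 1) ^ (-(γ - α))
  have hS : 0 < S := hs.tsum_pos (fun z => by positivity) 0 (by positivity)
  refine ⟨2 * (C * S), by positivity, fun x => ?_⟩
  have := meanHittingTime_le_of_le (initialWeight_pos α β) (C := C * S) (b := γ - α)
    (by positivity) (by linarith) (fun y => ?_) x
  · rwa [show 1 + (γ - α) = 1 - α + γ by ring] at this
  have hy : (0 : ℝ) < (y : ℝ) + 1 := by positivity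
  have hw := initialWeight_pos α β y
  calc ∑ z ∈ Finset.range (y + 1), initialWeight α β z
      ≤ ∑ z ∈ Finset.range (y + 1), C * ((y : ℝ) + 1) ^ (γ - α) * initialWeight α β y
          * ((z : ℝ) + 1) ^ (-(γ - α)) := by
        refine Finset.sum_le_sum fun z hz => ?_
        refine (h z y (Finset.mem_range_succ_iff.1 hz)).2.trans_eq ?_
        rw [Real.div_rpow hy.le (by positivity), Real.rpow_neg (by positivity)]
        ring
    _ = C * ((y : ℝ) + 1) ^ (γ - α) * initialWeight α β y *
          ∑ z ∈ Finset.range (y + 1), ((z : ℝ) + 1) ^ (-(γ - α)) := by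
        rw [← Finset.mul_sum]
    _ ≤ C * ((y : ℝ) + 1) ^ (γ - α) * initialWeight α β y * S := by
        gcongr
        exact hs.sum_le_tsum _ fun z _ => by positivity
    _ = _ := by ring

theorem le_meanHittingTime_of_le {w : ℕ → ℝ} {c p : ℝ} (hc : 0 < c) (hp : 1 ≤ p)
    (h : ∀ y : ℕ, c * ((y : ℝ) + 1) ^ (p - 1) ≤ (w y + 2 * ∑ z ∈ Finset.range y, w z) / w y)
    (x : ℕ) : c / p * (x : ℝ) ^ p ≤ meanHittingTime w x := by
  have hp0 : 0 < p := by linarith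
  calc c / p * (x : ℝ) ^ p
      ≤ c / p * (p * ∑ z ∈ Finset.range x, ((z : ℝ) + 1) ^ (p - 1)) := by
        gcongr; exact rpow_le_mul_sum_rpow hp x
    _ = ∑ z ∈ Finset.range x, c * ((z : ℝ) + 1) ^ (p - 1) := by
        rw [← Finset.mul_sum]; field_simp
    _ ≤ _ := Finset.sum_le_sum fun y _ => h y

/-- By Potter, earlier weights are at least a constant times `((z + 1) / (y + 1)) ^ a` times the
last one, with `a ≥ 0`; summing makes every passage time at least linear. -/
theorem sq_le_meanHittingTime_initialWeight (α β : ℝ) : ∃ c : ℝ, 0 < c ∧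
    ∀ x : ℕ, c * (x : ℝ) ^ (2 : ℝ) ≤ meanHittingTime (initialWeight α β) x := by
  obtain ⟨γ, hγ, ha⟩ : ∃ γ : ℝ, 0 < γ ∧ 0 ≤ α + γ :=
    ⟨|α| + 1, by positivity, by linarith [neg_abs_le α]⟩
  obtain ⟨C, hC, h⟩ := initialWeight_potter α β hγ
  set a := α + γ
  refine ⟨1 / (C * (a + 1)) / 2, by positivity, fun x =>
    le_meanHittingTime_of_le (by positivity) one_le_two (fun y => ?_) x⟩
  have hy : (0 : ℝ) < (y : ℝ) + 1 := by positivity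
  have hw := initialWeight_pos α β y
  rw [le_div_iff₀ hw]
  refine le_trans ?_ (sum_range_succ_le_add_two_mul (initialWeight_pos α β) y)
  rw [show (2 - 1 : ℝ) = 1 by norm_num, Real.rpow_one]
  have hs := rpow_le_mul_sum_rpow (p := a + 1) (by linarith) (y + 1)
  push_cast at hs
  rw [add_sub_cancel_right, Real.rpow_add_one hy.ne'] at hs
  calc 1 / (C * (a + 1)) * ((y : ℝ) + 1) * initialWeight α β y
      = 1 / (C * (a + 1)) * initialWeight α β y / ((y : ℝ) + 1) ^ a
          * (((y : ℝ) + 1) ^ a * ((y : ℝ) + 1)) := by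
        field_simp
    _ ≤ 1 / (C * (a + 1)) * initialWeight α β y / ((y : ℝ) + 1) ^ a
          * ((a + 1) * ∑ z ∈ Finset.range (y + 1), ((z : ℝ) + 1) ^ a) := by
        gcongr
    _ = ∑ z ∈ Finset.range (y + 1), initialWeight α β y / C
          * (((z : ℝ) + 1) ^ a / ((y : ℝ) + 1) ^ a) := by
        rw [← Finset.mul_sum, ← Finset.sum_div]
        field_simp
    _ ≤ _ := by
        refine Finset.sum_le_sum fun z hz => ?_
        have := (h z y (Finset.mem_range_succ_iff.1 hz)).1
        rw [Real.div_rpow hy.le (by positivity)] at this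
        have hz0 : (0 : ℝ) < ((z : ℝ) + 1) ^ a := by positivity
        have hy0 : (0 : ℝ) < ((y : ℝ) + 1) ^ a := by positivity
        calc _ ≤ (C * (((y : ℝ) + 1) ^ a / ((z : ℝ) + 1) ^ a) * initialWeight α β z) / C
              * (((z : ℝ) + 1) ^ a / ((y : ℝ) + 1) ^ a) := by gcongr
          _ = _ := by field_simp

theorem rpow_le_meanHittingTime_of_le_two (α β : ℝ) {p : ℝ} (hp : 0 < p) (hp2 : p ≤ 2) :
    ∃ c : ℝ, 0 < c ∧ ∀ x : ℕ, c * (x : ℝ) ^ p ≤ meanHittingTime (initialWeight α β) x := by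
  obtain ⟨c, hc, h⟩ := sq_le_meanHittingTime_initialWeight α β
  refine ⟨c, hc, fun x => le_trans (mul_le_mul_of_nonneg_left ?_ hc.le) (h x)⟩
  rcases Nat.eq_zero_or_pos x with rfl | hx
  · simp [Real.zero_rpow hp.ne']
  · exact Real.rpow_le_rpow_of_exponent_le (Nat.one_le_cast.2 hx) hp2

theorem rpow_le_meanHittingTime_initialWeight {α γ : ℝ} (β : ℝ) (hγ : 0 < γ)
    (hp : 0 < 1 - α - γ) : ∃ c : ℝ, 0 < c ∧
      ∀ x : ℕ, c * (x : ℝ) ^ (1 - α - γ) ≤ meanHittingTime (initialWeight α β) x := by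
  rcases le_total (1 - α - γ) 1 with h1 | h1
  -- Below exponent 1 the power-sum comparison is unavailable, but the quadratic bound is already
  -- stronger.
  · exact rpow_le_meanHittingTime_of_le_two α β hp (by linarith)
  obtain ⟨C, hC, h⟩ := initialWeight_potter α β hγ
  refine ⟨1 / C / (1 - α - γ), by positivity, fun x =>
    le_meanHittingTime_of_le (by positivity) h1 (fun y => ?_) x⟩
  have hy : (0 : ℝ) < (y : ℝ) + 1 := by positivity
  have hw := initialWeight_pos α β y
  rw [le_div_iff₀ hw]
  refine le_trans ?_ (sum_range_succ_le_add_two_mul (initialWeight_pos α β) y)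
  -- Of all edges to the left, only the edge at the origin is kept.
  have h0 : initialWeight α β 0 = 1 := by simp [initialWeight]
  have h2 : (1 : ℝ) ≤ ∑ z ∈ Finset.range (y + 1), initialWeight α β z := by
    rw [← h0]
    exact Finset.single_le_sum (fun z _ => (initialWeight_pos α β z).le)
      (Finset.mem_range.2 (Nat.succ_pos y))
  refine le_trans ?_ h2
  have h3 := (h 0 y (Nat.zero_le y)).1
  rw [h0, Nat.cast_zero, zero_add, div_one, mul_one] at h3
  rw [show 1 - α - γ - 1 = -(α + γ) by ring, Real.rpow_neg hy.le, mul_assoc, one_div,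
    ← div_eq_inv_mul, div_le_one hC, ← div_eq_inv_mul, div_le_iff₀ (by positivity)]
  exact h3

/-! ### From hitting times to almost sure growth -/

theorem frequently_mul_rpow_le {x : ℕ → ℕ} {M e : ℝ} (hM : 0 < M) (he : 0 < e)
    (h : ¬ ∀ᶠ y : ℕ in atTop, ∀ i ≤ ⌊((y : ℝ) / M) ^ (1 / e)⌋₊, x i < y) :
    ∃ᶠ k : ℕ in atTop, M * (k : ℝ) ^ e ≤ x k := by
  rw [frequently_atTop]
  intro K
  simp only [Filter.not_eventually, not_forall, not_lt] at h
  -- A level above everything visited up to time `K` can only be reached after `K`, so the times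
  -- found are unbounded.
  obtain ⟨y, hy, i, hi, hxy⟩ := (frequently_atTop.1 h) ((Finset.range (K + 1)).sup x + 1)
  refine ⟨i, ?_, ?_⟩
  · by_contra! hiK
    have := Finset.le_sup (f := x) (Finset.mem_range.2 (show i < K + 1 by omega))
    omega
  · have hy0 : (0 : ℝ) ≤ (y : ℝ) / M := by positivity
    have h1 : (i : ℝ) ≤ ((y : ℝ) / M) ^ (1 / e) := (Nat.le_floor_iff (by positivity)).1 hi
    have h2 := Real.rpow_le_rpow i.cast_nonneg h1 he.le
    rw [← Real.rpow_mul hy0, one_div_mul_cancel he.ne', Real.rpow_one, le_div_iff₀ hM] at h2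
    calc M * (i : ℝ) ^ e = (i : ℝ) ^ e * M := mul_comm _ _
      _ ≤ y := h2
      _ ≤ x i := by exact_mod_cast hxy

theorem le_limsupRatio_of_frequently {x : ℕ → ℕ} {M e : ℝ}
    (h : ∃ᶠ k : ℕ in atTop, M * (k : ℝ) ^ e ≤ x k) :
    (M : EReal) ≤ limsupRatio x (fun n => (n : ℝ) ^ e) := by
  refine le_limsup_of_frequently_le' ?_
  refine (h.and_eventually (eventually_ge_atTop 1)).mono fun k hk => ?_
  have hk0 : (0 : ℝ) < k := by exact_mod_cast hk.2
  rw [EReal.coe_le_coe_iff, le_div_iff₀ (by positivity)]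
  exact hk.1

/-- Continuity from below, as in Fatou's lemma for sets. -/
theorem measure_setOf_eventually_le {Ω : Type*} [MeasurableSpace Ω] {μ : Measure Ω}
    {p : ℕ → Ω → Prop} {η : ENNReal} (h : ∀ᶠ x in atTop, μ {ω | p x ω} ≤ η) :
    μ {ω | ∀ᶠ x in atTop, p x ω} ≤ η := by
  have e : {ω | ∀ᶠ x in atTop, p x ω} = ⋃ a : ℕ, {ω | ∀ x ≥ a, p x ω} := by
    ext ω
    simp [eventually_atTop]
  have hmono : Monotone fun a : ℕ => {ω | ∀ x ≥ a, p x ω} :=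
    fun a b hab ω hω x hx => hω x (hab.trans hx)
  rw [e, hmono.measure_iUnion]
  refine iSup_le fun a => ?_
  obtain ⟨x, hx, hxa⟩ := (h.and (eventually_ge_atTop a)).exists
  have hsub : {ω | ∀ x ≥ a, p x ω} ⊆ {ω | p x ω} := fun ω hω => hω x hxa
  exact (measure_mono hsub).trans hx

section Walk

variable {Ω : Type*} [MeasurableSpace Ω] {μ : Measure Ω} {X : ℕ → Ω → ℕ} {w : ℕ → ℝ}

theorem IsLERRW.measureReal_lt_floor_le [IsProbabilityMeasure μ] (hX : IsLERRW w 0 μ X)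
    (hw : ∀ x, 0 < w x) {C s M e : ℝ} (hM : 0 < M) {x : ℕ} (hx : 0 < x)
    (hF : meanHittingTime w x ≤ C * (x : ℝ) ^ s) :
    μ.real {ω | ∀ i ≤ ⌊((x : ℝ) / M) ^ (1 / e)⌋₊, X i ω < x} ≤
      C * M ^ (1 / e) * (x : ℝ) ^ (s - 1 / e) := by
  have hx0 : (0 : ℝ) < x := by exact_mod_cast hx
  have h1 := hX.measureReal_lt_le hw hx ⌊((x : ℝ) / M) ^ (1 / e)⌋₊
  have h2 := (Nat.lt_floor_add_one (((x : ℝ) / M) ^ (1 / e))).le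
  have h3 := (mul_le_mul_of_nonneg_right h2 measureReal_nonneg).trans (h1.trans hF)
  have h4 : 0 < ((x : ℝ) / M) ^ (1 / e) := by positivity
  rw [mul_comm, ← le_div_iff₀ h4] at h3
  refine h3.trans_eq ?_
  rw [Real.div_rpow hx0.le hM.le, Real.rpow_sub hx0]
  field_simp

/-- Below the critical exponent `1 / s`, the probability of reaching `x` late tends to 0, so almost
surely infinitely many levels are reached early, for every constant `m + 1`. -/
theorem IsLERRW.ae_limsupRatio_eq_top [IsProbabilityMeasure μ] (hX : IsLERRW w 0 μ X)
    (hw : ∀ x, 0 < w x) {C s e : ℝ} (hs : 0 < s) (hes : e < 1 / s)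
    (hF : ∀ x : ℕ, meanHittingTime w x ≤ C * (x : ℝ) ^ s) :
    ∀ᵐ ω ∂μ, limsupRatio (fun n => X n ω) (fun n => (n : ℝ) ^ e) = ⊤ := by
  -- The exponent `e` may be negative or zero, so the argument runs with a positive `e'` instead.
  obtain ⟨e', h1, h2⟩ := exists_between (max_lt hes (by positivity : 0 < 1 / s))
  have he' : 0 < e' := (le_max_right _ _).trans_lt h1
  have hee' : e ≤ e' := ((le_max_left _ _).trans_lt h1).le
  have hse : 0 < 1 / e' - s := by
    rw [lt_div_iff₀ hs] at h2
    rw [sub_pos, lt_div_iff₀ he']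
    linarith
  have key : ∀ m : ℕ, ∀ᵐ ω ∂μ, ∃ᶠ k : ℕ in atTop, ((m : ℝ) + 1) * (k : ℝ) ^ e' ≤ X k ω := by
    intro m
    have hM : (0 : ℝ) < (m : ℝ) + 1 := by positivity
    have hz : μ {ω | ∀ᶠ x : ℕ in atTop, ∀ i ≤ ⌊((x : ℝ) / ((m : ℝ) + 1)) ^ (1 / e')⌋₊,
        X i ω < x} = 0 := by
      -- The minimum with 1 below keeps `toReal` meaningful when `η` is infinite.
      refine le_antisymm (le_of_forall_gt fun η hη => ?_) zero_le
      refine lt_of_le_of_lt (measure_setOf_eventually_le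
        (η := ENNReal.ofReal ((min η 1).toReal / 2)) ?_) ?_
      · have hη' : 0 < (min η 1).toReal / 2 := by
          have : 0 < (min η 1).toReal :=
            ENNReal.toReal_pos (by simp [hη.ne']) (by simp)
          linarith
        have ht : Tendsto (fun x : ℕ => C * ((m : ℝ) + 1) ^ (1 / e') * (x : ℝ) ^ (-(1 / e' - s)))
            atTop (𝓝 (C * ((m : ℝ) + 1) ^ (1 / e') * 0)) :=
          ((tendsto_rpow_neg_atTop hse).comp tendsto_natCast_atTop_atTop).const_mul _
        rw [mul_zero] at ht
        filter_upwards [ht.eventually_lt_const hη', eventually_gt_atTop 0] with x hx hx0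
        have := hX.measureReal_lt_floor_le hw (e := e') hM hx0 (hF x)
        rw [neg_sub] at hx
        rw [← ofReal_measureReal]
        exact ENNReal.ofReal_le_ofReal (this.trans hx.le)
      · have hp : 0 < (min η 1).toReal :=
          ENNReal.toReal_pos (by simp [hη.ne']) (by simp)
        calc ENNReal.ofReal ((min η 1).toReal / 2) < ENNReal.ofReal ((min η 1).toReal) :=
              (ENNReal.ofReal_lt_ofReal_iff hp).2 (by linarith)
          _ = min η 1 := ENNReal.ofReal_toReal (by simp)
          _ ≤ η := min_le_left _ _
    have hz' : ∀ᵐ ω ∂μ, ¬ ∀ᶠ x : ℕ in atTop,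
        ∀ i ≤ ⌊((x : ℝ) / ((m : ℝ) + 1)) ^ (1 / e')⌋₊, X i ω < x := by
      rw [ae_iff]
      simpa only [not_not] using hz
    filter_upwards [hz'] with ω hω
    exact frequently_mul_rpow_le hM he' hω
  filter_upwards [ae_all_iff.2 key] with ω hω
  rw [EReal.eq_top_iff_forall_lt]
  intro y
  obtain ⟨m, hm⟩ := exists_nat_gt y
  refine lt_of_lt_of_le (EReal.coe_lt_coe_iff.2 (show y < (m : ℝ) + 1 by linarith))
    (le_limsupRatio_of_frequently ?_)
  refine ((hω m).and_eventually (eventually_ge_atTop 1)).mono fun k hk => ?_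
  refine le_trans ?_ hk.1
  gcongr
  exact_mod_cast hk.2

/-- At the critical exponent the late-arrival probability no longer decays in `x`, but is at most `C
* M ^ 2`; a vanishing limsup would be a late arrival for every `M`, so let `M` tend to 0. -/
theorem IsLERRW.ae_limsupRatio_sqrt_pos [IsProbabilityMeasure μ] (hX : IsLERRW w 0 μ X)
    (hw : ∀ x, 0 < w x) {C : ℝ}
    (hF : ∀ x : ℕ, meanHittingTime w x ≤ C * (x : ℝ) ^ (2 : ℝ)) :
    ∀ᵐ ω ∂μ, 0 < limsupRatio (fun n => X n ω) (fun n => (n : ℝ) ^ (1 / 2 : ℝ)) := by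
  rw [ae_iff]
  have key : ∀ M : ℝ, 0 < M → μ {ω | ¬ 0 < limsupRatio (fun n => X n ω)
      (fun n => (n : ℝ) ^ (1 / 2 : ℝ))} ≤ ENNReal.ofReal (C * M ^ (2 : ℝ)) := by
    intro M hM
    refine le_trans (measure_mono fun ω hω => ?_) (measure_setOf_eventually_le
      (p := fun x ω => ∀ i ≤ ⌊((x : ℝ) / M) ^ (1 / (1 / 2 : ℝ))⌋₊, X i ω < x) ?_)
    · by_contra hcon
      refine hω (lt_of_lt_of_le ?_ (le_limsupRatio_of_frequently
        (frequently_mul_rpow_le hM one_half_pos hcon)))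
      exact_mod_cast hM
    · filter_upwards [eventually_gt_atTop 0] with x hx
      have := hX.measureReal_lt_floor_le hw (e := 1 / 2) hM hx (hF x)
      rw [show (2 - 1 / (1 / 2) : ℝ) = 0 by norm_num, Real.rpow_zero, mul_one] at this
      rw [← ofReal_measureReal]
      refine ENNReal.ofReal_le_ofReal (this.trans_eq ?_)
      norm_num
  have ht : Tendsto (fun m : ℕ => ENNReal.ofReal (C * (1 / ((m : ℝ) + 1)) ^ (2 : ℝ))) atTop
      (𝓝 0) := by
    have h1 := ((tendsto_one_div_add_atTop_nhds_zero_nat (𝕜 := ℝ)).rpow_const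
      (p := 2) (Or.inr (by norm_num))).const_mul C
    rw [Real.zero_rpow two_ne_zero, mul_zero] at h1
    simpa using ENNReal.tendsto_ofReal h1
  exact le_antisymm (ge_of_tendsto' ht fun m => key _ (by positivity)) zero_le

/-- Borel–Cantelli on dyadic time blocks: `E k` compares the maximum up to the end of a block with
the threshold `a k` at its start. The power of the logarithm makes the probabilities summable, of
order `(k + 1) ^ (-(1 + ε))`. -/
theorem IsLERRW.ae_eventually_lt [IsProbabilityMeasure μ] (hX : IsLERRW w 0 μ X)
    (hw : ∀ x, 0 < w x) {c p ε δ : ℝ} (hc : 0 < c) (hp : 0 < p) (hε : 0 < ε) (hδ : 0 < δ)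
    (hF : ∀ x : ℕ, c * (x : ℝ) ^ p ≤ meanHittingTime w x) :
    ∀ᵐ ω ∂μ, ∀ᶠ n : ℕ in atTop,
      (X n ω : ℝ) < δ * ((n : ℝ) * Real.log n ^ (1 + ε)) ^ (1 / p) := by
  have hl2 : 0 < Real.log 2 := Real.log_pos one_lt_two
  -- Blocks start at `2 ^ (k + 1)`, so that the logarithm is positive already at `k = 0`.
  set a : ℕ → ℝ := fun k => δ * ((2 : ℝ) ^ (k + 1) * Real.log (2 ^ (k + 1)) ^ (1 + ε)) ^ (1 / p)
  have hlog : ∀ k : ℕ, Real.log (2 ^ (k + 1)) = ((k : ℝ) + 1) * Real.log 2 := fun k => by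
    rw [Real.log_pow]; push_cast; ring
  have ha : ∀ k, 0 < a k := fun k => by
    have : 0 < Real.log (2 ^ (k + 1)) := by rw [hlog]; positivity
    positivity
  set E : ℕ → Set Ω := fun k => {ω | ∃ i ≤ 2 ^ (k + 2), ⌈a k⌉₊ ≤ X i ω}
  set B : ℝ := 2 / (c * δ ^ p * Real.log 2 ^ (1 + ε))
  have hE : ∀ k, μ (E k) ≤ ENNReal.ofReal (B * ((k : ℝ) + 1) ^ (-(1 + ε))) := by
    intro k
    have h1 := hX.measureReal_exists_ge_le hw (Nat.ceil_pos.2 (ha k)) (2 ^ (k + 2))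
    have h2 : c * a k ^ p ≤ meanHittingTime w ⌈a k⌉₊ := by
      refine le_trans ?_ (hF _)
      gcongr
      · exact (ha k).le
      · exact Nat.le_ceil _
    have h3 : a k ^ p = δ ^ p *
        (2 ^ (k + 1) * (((k : ℝ) + 1) ^ (1 + ε) * Real.log 2 ^ (1 + ε))) := by
      have hpos : 0 < Real.log (2 ^ (k + 1)) := by rw [hlog]; positivity
      simp only [a]
      rw [Real.mul_rpow hδ.le (by positivity), ← Real.rpow_mul (by positivity),
        one_div_mul_cancel hp.ne', Real.rpow_one, hlog, Real.mul_rpow (by positivity) hl2.le]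
    have h4 := (mul_le_mul_of_nonneg_right h2 measureReal_nonneg).trans h1
    rw [← ofReal_measureReal]
    refine ENNReal.ofReal_le_ofReal ?_
    have h5 : 0 < c * a k ^ p := mul_pos hc (Real.rpow_pos_of_pos (ha k) _)
    rw [mul_comm, ← le_div_iff₀ h5] at h4
    refine h4.trans_eq ?_
    rw [h3, Real.rpow_neg (by positivity)]
    simp only [B]
    push_cast
    rw [pow_succ (2 : ℝ) (k + 1)]
    field_simp
  have hsum : Summable fun k : ℕ => B * ((k : ℝ) + 1) ^ (-(1 + ε)) := by
    have := (summable_nat_add_iff 1).2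
      (Real.summable_nat_rpow (p := -(1 + ε)).2 (by linarith))
    simpa using this.mul_left B
  have hfin : ∑' k, μ (E k) ≠ ⊤ :=
    ne_top_of_le_ne_top hsum.tsum_ofReal_ne_top (ENNReal.tsum_le_tsum hE)
  filter_upwards [ae_eventually_notMem hfin] with ω hω
  obtain ⟨K, hK⟩ := eventually_atTop.1 hω
  filter_upwards [eventually_ge_atTop (2 ^ (K + 1))] with n hn
  have hn0 : n ≠ 0 := by
    have := Nat.one_le_two_pow (n := K + 1)
    omega
  have hlogn := Nat.le_log_of_pow_le one_lt_two hn
  obtain ⟨k, hk⟩ : ∃ k, Nat.log 2 n = k + 1 := ⟨Nat.log 2 n - 1, by omega⟩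
  have hlow : 2 ^ (k + 1) ≤ n := hk ▸ Nat.pow_log_le_self 2 hn0
  have hupp : n < 2 ^ (k + 2) := by
    have := Nat.lt_pow_succ_log_self one_lt_two n
    rwa [hk] at this
  have hnot := hK k (by omega)
  simp only [E, Set.mem_ofPred_eq, not_exists, not_and, not_le] at hnot
  refine (Nat.lt_ceil.1 (hnot n hupp.le)).trans_le ?_
  have hlow' : (2 : ℝ) ^ (k + 1) ≤ n := by exact_mod_cast hlow
  have hpos : 0 < Real.log (2 ^ (k + 1)) := by rw [hlog]; positivity
  simp only [a]
  gcongr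

theorem IsLERRW.ae_tendsto_zero [IsProbabilityMeasure μ] (hX : IsLERRW w 0 μ X)
    (hw : ∀ x, 0 < w x) {c p ε : ℝ} (hc : 0 < c) (hp : 0 < p) (hε : 0 < ε)
    (hF : ∀ x : ℕ, c * (x : ℝ) ^ p ≤ meanHittingTime w x) :
    ∀ᵐ ω ∂μ, Tendsto (fun n : ℕ => (X n ω : ℝ) /
      ((n : ℝ) * Real.log n ^ (1 + ε)) ^ (1 / p)) atTop (𝓝 0) := by
  have h := ae_all_iff.2 fun m : ℕ =>
    hX.ae_eventually_lt hw hc hp hε (by positivity : (0 : ℝ) < 1 / ((m : ℝ) + 1)) hF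
  filter_upwards [h] with ω hω
  rw [Metric.tendsto_nhds]
  intro δ hδ
  obtain ⟨m, hm⟩ := exists_nat_one_div_lt hδ
  filter_upwards [hω m, eventually_ge_atTop 2] with n hn hn2
  have hn1 : (1 : ℝ) < n := by exact_mod_cast hn2
  have hlog := Real.log_pos hn1
  have hpos : 0 < ((n : ℝ) * Real.log n ^ (1 + ε)) ^ (1 / p) := by positivity
  rw [Real.dist_0_eq_abs, abs_of_nonneg (by positivity)]
  exact ((div_lt_iff₀ hpos).2 hn).trans hm

end Walk

/-! ### The five regimes -/

theorem theorem2p9 {Ω : Type*} [MeasurableSpace Ω] (μ : Measure Ω) [IsProbabilityMeasure μ]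
    (α β : ℝ) (hβ : β ≠ 0) (X : ℕ → Ω → ℕ) (hX : IsLERRW (initialWeight α β) 0 μ X) :
    (α < -1 → ∀ ε : ℝ, 0 < ε →
      (∀ᵐ ω ∂μ, limsupRatio (fun n => X n ω)
        (fun n => (n : ℝ) ^ (1 / (1 - α + ε * |β|))) = ⊤) ∧
      (0 < 1 - α - ε * |β| →
        ∀ᵐ ω ∂μ, Tendsto (fun n : ℕ => (X n ω : ℝ) /
          ((n : ℝ) * Real.log n ^ (1 + ε)) ^ (1 / (1 - α - ε * |β|))) atTop (𝓝 0))) ∧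
    (α = -1 → β < -1 → ∀ ε : ℝ, 0 < ε →
      (∀ᵐ ω ∂μ, limsupRatio (fun n => X n ω)
        (fun n => (n : ℝ) ^ (1 / (2 - ε * β))) = ⊤) ∧
      (0 < 2 + ε * β →
        ∀ᵐ ω ∂μ, Tendsto (fun n : ℕ => (X n ω : ℝ) /
          ((n : ℝ) * Real.log n ^ (1 + ε)) ^ (1 / (2 + ε * β))) atTop (𝓝 0))) ∧
    (α = -1 → -1 ≤ β → ∀ ε : ℝ, 0 < ε →
      (∀ᵐ ω ∂μ, limsupRatio (fun n => X n ω)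
        (fun n => (n : ℝ) ^ ((1 - ε) / 2)) = ⊤) ∧
      (∀ᵐ ω ∂μ, Tendsto (fun n : ℕ => (X n ω : ℝ) /
          ((n : ℝ) * Real.log n ^ (1 + ε)) ^ (1 / 2 : ℝ)) atTop (𝓝 0))) ∧
    (-1 < α → α ≤ 0 → ∀ ε : ℝ, 0 < ε →
      (∀ᵐ ω ∂μ, 0 < limsupRatio (fun n => X n ω)
        (fun n => (n : ℝ) ^ (1 / 2 : ℝ))) ∧
      (∀ᵐ ω ∂μ, Tendsto (fun n : ℕ => (X n ω : ℝ) /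
          ((n : ℝ) * Real.log n ^ (1 + ε)) ^ (1 / 2 : ℝ)) atTop (𝓝 0))) ∧
    ((0 < α ∧ α < 1) ∨ (α = 1 ∧ β ≤ 1) → ∀ ε : ℝ, 0 < ε →
      (∀ᵐ ω ∂μ, limsupRatio (fun n => X n ω)
        (fun n => (n : ℝ) ^ (1 / (2 * (1 + ε * |β|)))) = ⊤) ∧
      (0 < 1 - ε * |β| →
        ∀ᵐ ω ∂μ, Tendsto (fun n : ℕ => (X n ω : ℝ) /
          ((n : ℝ) * Real.log n ^ (1 + ε)) ^ (1 / (2 * (1 - ε * |β|)))) atTop (𝓝 0))) := by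
  have hw := initialWeight_pos α β
  have hβ' : 0 < |β| := abs_pos.2 hβ
  refine ⟨fun hα ε hε => ⟨?_, fun hp => ?_⟩, fun hα hβ1 ε hε => ⟨?_, fun hp => ?_⟩,
    fun hα hβ1 ε hε => ⟨?_, ?_⟩, fun hα hα' ε hε => ⟨?_, ?_⟩, fun h ε hε => ⟨?_, fun hp => ?_⟩⟩
  · have hεβ : 0 < ε * |β| := mul_pos hε hβ'
    obtain ⟨C, -, hF⟩ := meanHittingTime_initialWeight_le_rpow (α := α) β hα.le (half_pos hεβ)
    exact hX.ae_limsupRatio_eq_top hw (by linarith)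
      (one_div_lt_one_div_of_lt (by linarith) (by linarith)) hF
  · obtain ⟨c, hc, hF⟩ := rpow_le_meanHittingTime_initialWeight β (mul_pos hε hβ') hp
    exact hX.ae_tendsto_zero hw hc hp hε hF
  · have hεβ : 0 < -(ε * β) := by nlinarith
    obtain ⟨C, -, hF⟩ := meanHittingTime_initialWeight_le_rpow (α := α) β hα.le (half_pos hεβ)
    exact hX.ae_limsupRatio_eq_top hw (by linarith)
      (one_div_lt_one_div_of_lt (by linarith) (by linarith)) hF
  · obtain ⟨c, hc, hF⟩ := rpow_le_meanHittingTime_of_le_two α β hp (by nlinarith)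
    exact hX.ae_tendsto_zero hw hc hp hε hF
  · obtain ⟨C, -, hF⟩ := meanHittingTime_initialWeight_le_rpow (α := α) β hα.le hε
    refine hX.ae_limsupRatio_eq_top hw (by linarith) ?_ hF
    -- With `α = -1` the claim is `(1 - ε) / 2 < 1 / (2 + ε)`, that is `(1 - ε) * (2 + ε) = 2 - ε -
    -- ε ^ 2 < 2`.
    rw [hα, lt_div_iff₀ (by linarith)]
    nlinarith
  · obtain ⟨c, hc, hF⟩ := sq_le_meanHittingTime_initialWeight α β
    exact hX.ae_tendsto_zero hw hc two_pos hε hF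
  · obtain ⟨C, -, hF⟩ := meanHittingTime_initialWeight_le_sq β hα
    exact hX.ae_limsupRatio_sqrt_pos hw hF
  · obtain ⟨c, hc, hF⟩ := sq_le_meanHittingTime_initialWeight α β
    exact hX.ae_tendsto_zero hw hc two_pos hε hF
  · have hεβ : 0 < ε * |β| := mul_pos hε hβ'
    have hα : -1 < α := by rcases h with h | h <;> linarith [h.1]
    obtain ⟨C, -, hF⟩ := meanHittingTime_initialWeight_le_sq β hα
    exact hX.ae_limsupRatio_eq_top hw two_pos
      (one_div_lt_one_div_of_lt two_pos (by linarith)) hF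
  · have hεβ : 0 < ε * |β| := mul_pos hε hβ'
    have hp' : 0 < 2 * (1 - ε * |β|) := by linarith
    obtain ⟨c, hc, hF⟩ := rpow_le_meanHittingTime_of_le_two α β hp' (by linarith)
    exact hX.ae_tendsto_zero hw hc hp' hε hF
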